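/- Let $N\ge 2$ and let $\Omega\subset\mathbb{R}^N$ be a bounded convex domain whose boundary is of class $C^2$. Write $d(x)=\mathrm{dist}(x,\partial\Omega)$. Then there exists a constant $C>0$, depending only on $\Omega$ (and $N$), such that for every real-valued $u\in C_c^\infty(\Omega)$ $$\left(\int_\Omega\Big(|\nabla u|^2-\frac{u^2}{4d^2}\Big)\,dx\right)\left(\int_\Omega u^2\,dx\right)^{2/N}\;\ge\; C\int_\Omega |u|^{2(1+2/N)}\,dx .$$ -/

import Mathlib

open scoped ContDiff

/-- The boundary of `Ω ⊆ ℝᴺ` is of class `C²` : near each boundary point `p` there are a unit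
vector `e` (the last axis of a rotated Cartesian coordinate system) and a `C²` function `a` of the
remaining coordinates, i.e. of the orthogonal projection onto the hyperplane `eᗮ`, such that in
a ball around `p` the set `Ω` is exactly the part strictly below the graph of `a`. -/
def HasC2Boundary {N : ℕ} (Ω : Set (EuclideanSpace ℝ (Fin N))) : Prop :=
  ∀ p ∈ frontier Ω, ∃ e : EuclideanSpace ℝ (Fin N), ‖e‖ = 1 ∧
    ∃ a : (Submodule.span ℝ {e})ᗮ → ℝ, ContDiff ℝ 2 a ∧
      ∃ r : ℝ, 0 < r ∧ ∀ x ∈ Metric.ball p r,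
        (x ∈ Ω ↔ inner ℝ e x < a ((Submodule.span ℝ {e})ᗮ.orthogonalProjectionOnto x))

/-- The space `C_c^∞(Ω)` of smooth real functions with compact support contained in `Ω`
(extended by zero to all of `ℝᴺ`). -/
def IsTestFunction {N : ℕ} (Ω : Set (EuclideanSpace ℝ (Fin N)))
    (u : EuclideanSpace ℝ (Fin N) → ℝ) : Prop :=
  ContDiff ℝ ∞ u ∧ HasCompactSupport u ∧ tsupport u ⊆ Ω

/-- The distance `d(x) = dist(x, ∂Ω)` to the boundary. -/
noncomputable def boundaryDist {N : ℕ} (Ω : Set (EuclideanSpace ℝ (Fin N)))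
    (x : EuclideanSpace ℝ (Fin N)) : ℝ :=
  Metric.infDist x (frontier Ω)

/-! The argument is a Gagliardo–Nirenberg proof in which the squared derivative along each
coordinate line is replaced by a nonnegative Hardy remainder. On an interval with distances `α`, `β`
to its ends, expanding the square in `hardyDensity` and integrating by parts turns its integral into
that of `f'² - f²(1/α² + 1/β²)/4`. The remainder still controls `f` pointwise: multiplying `f` by
`√(β/α)` and integrating from a point of the left half towards `b` bounds `|f t|^k` by the line
integral of `lam * hardyDensity + |f|^(2k-2)/lam`, up to the factor `k` (`abs_rpow_le_lintegral`).

A convex domain meets coordinate lines in intervals, so this bound holds in every direction. The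
grid-lines inequality `lintegral_prod_lintegral_pow_le` combines the directions; optimising in `lam`
and interpolating `∫ |u|^(2k-2)` between `L²` and the target norm gives the estimate with the summed
remainders as energy (`exists_const_integral_rpow_le`).

Convexity also compares energies. Let `ν` be a unit normal of a supporting hyperplane at a nearest
boundary point. Along `e_i` the domain is left within `d/|ν i|` on one side, so the Hardy weights
sum to at least `∑ ν i²/d² = 1/d²` (`one_div_sq_boundaryDist_le`). Hence the summed remainders are
at most the energy of the theorem. -/

open MeasureTheory Set

/-! ### One-dimensional pointwise bounds by the Hardy remainder. -/

/-- The one-dimensional Hardy remainder density at a point at distances `α`, `β` from the two ends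
of an interval, for a function with value `y` and derivative `z` there. -/
noncomputable def hardyDensity (α β y z : ℝ) : ℝ :=
  (z - y * (1 / α - 1 / β) / 2) ^ 2 + y ^ 2 / (2 * (α * β))

lemma hardyDensity_swap (α β y z : ℝ) : hardyDensity α β y z = hardyDensity β α y (-z) := by
  unfold hardyDensity
  rw [mul_comm α β]
  ring

lemma mul_le_weighted_sq {lam : ℝ} (hl : 0 < lam) (x y : ℝ) :
    x * y ≤ (lam * y ^ 2 + x ^ 2 / lam) / 2 := by
  have h : lam * y ^ 2 + x ^ 2 / lam - 2 * (x * y) = (lam * y - x) ^ 2 / lam := by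
    field_simp
    ring
  have : 0 ≤ (lam * y - x) ^ 2 / lam := by positivity
  linarith

lemma abs_rpow_sq (y k : ℝ) : (|y| ^ (k - 1)) ^ 2 = |y| ^ (2 * k - 2) := by
  rw [← Real.rpow_natCast, ← Real.rpow_mul (abs_nonneg y)]
  congr 1
  push_cast
  ring

/-- Weighted Young applied to each product. The factor `1/2` from Young is exactly the one in
`y²/(2αβ)`; half of the square term is given away. -/
lemma mul_add_le_hardyDensity {α β lam k : ℝ} (hα : 0 < α) (hβ : 0 < β) (hl : 0 < lam) (y z : ℝ) :
    |y| ^ (k - 1) * (|z - y * (1 / α - 1 / β) / 2| + |y| / √(α * β)) ≤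
      lam * hardyDensity α β y z + |y| ^ (2 * k - 2) / lam := by
  have h1 := mul_le_weighted_sq hl (|y| ^ (k - 1)) |z - y * (1 / α - 1 / β) / 2|
  have h2 := mul_le_weighted_sq hl (|y| ^ (k - 1)) (|y| / √(α * β))
  rw [abs_rpow_sq, sq_abs] at h1
  rw [abs_rpow_sq, div_pow, sq_abs, Real.sq_sqrt (by positivity)] at h2
  unfold hardyDensity
  have h3 : y ^ 2 / (α * β) = 2 * (y ^ 2 / (2 * (α * β))) := by field_simp
  rw [h3] at h2
  have h4 : 0 ≤ lam * (z - y * (1 / α - 1 / β) / 2) ^ 2 := by positivity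
  rw [mul_add, mul_add]
  linarith

/-- The logarithmic derivative of `√(β/α)` is `-(1/α + 1/β)/2 = -(1/α - 1/β)/2 - 1/β`, so this
multiplier produces the combination squared in `hardyDensity`, with the error `f/β`. -/
lemma hasDerivAt_mul_sqrt_ratio {a b s r : ℝ} (has : a < s) (hsb : s < b) (hr : 0 < r)
    {f : ℝ → ℝ} {z : ℝ} (hf : HasDerivAt f z s) :
    HasDerivAt (fun s => f s * √((b - s) / (s - a) / r))
      (√((b - s) / (s - a) / r) * (z - f s * (1 / (s - a) - 1 / (b - s)) / 2 - f s / (b - s))) s := by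
  have hα : 0 < s - a := by linarith
  have hβ : 0 < b - s := by linarith
  have h1 : HasDerivAt (fun s => (b - s) / (s - a) / r)
      (((-1) * (s - a) - (b - s) * 1) / (s - a) ^ 2 / r) s :=
    (((hasDerivAt_id s).const_sub b).div ((hasDerivAt_id s).sub_const a) hα.ne').div_const r
  have hp : 0 < (b - s) / (s - a) / r := by positivity
  refine (hf.mul (h1.sqrt hp.ne')).congr_deriv ?_
  have hs := Real.sqrt_pos.2 hp
  have hsq := Real.sq_sqrt hp.le
  set q := √((b - s) / (s - a) / r) with hq
  have : ((-1) * (s - a) - (b - s) * 1) / (s - a) ^ 2 / r =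
      - q ^ 2 * (1 / (s - a) + 1 / (b - s)) := by
    rw [hsq]
    field_simp
    ring
  rw [this]
  field_simp
  ring

/-- The fundamental theorem of calculus for `|g|^k`, where `g` is `f` times `√(β/α)` normalised to
be `1` at `t`. As `β/α` decreases, the multiplier stays at most `1` to the right of `t`. -/
lemma abs_rpow_le_integral_of_left {a b t c lam k : ℝ} (hk : 2 ≤ k) (hl : 0 < lam)
    (hat : a < t) (htc : t ≤ c) (hcb : c < b) (hmid : t - a ≤ b - t)
    {f f' : ℝ → ℝ} (hf : ∀ s, HasDerivAt f (f' s) s) (hf' : Continuous f') (hc : f c = 0) :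
    |f t| ^ k ≤ k * ∫ s in t..c,
      (lam * hardyDensity (s - a) (b - s) (f s) (f' s) + |f s| ^ (2 * k - 2) / lam) := by
  set W : ℝ → ℝ := fun s =>
    lam * hardyDensity (s - a) (b - s) (f s) (f' s) + |f s| ^ (2 * k - 2) / lam with hW
  have hfc : Continuous f := continuous_iff_continuousAt.2 fun s => (hf s).continuousAt
  have hWc : ContinuousOn W (Icc t c) := by
    have e1 : ∀ s ∈ Icc t c, s - a ≠ 0 := fun s hs => by
      have := hs.1
      exact (by linarith : 0 < s - a).ne'
    have e2 : ∀ s ∈ Icc t c, b - s ≠ 0 := fun s hs => by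
      have := hs.2
      exact (by linarith : 0 < b - s).ne'
    have c1 : ContinuousOn (fun s : ℝ => s - a) (Icc t c) := by fun_prop
    have c2 : ContinuousOn (fun s : ℝ => b - s) (Icc t c) := by fun_prop
    have c3 : ContinuousOn (fun s => |f s| ^ (2 * k - 2)) (Icc t c) :=
      (hfc.abs.rpow_const fun _ => Or.inr (by linarith)).continuousOn
    have c4 := hfc.continuousOn (s := Icc t c)
    have c5 := hf'.continuousOn (s := Icc t c)
    have c6 := continuousOn_const (c := (1 : ℝ)) (s := Icc t c)
    refine ((((c5.sub ((c4.mul ((c6.div c1 e1).sub (c6.div c2 e2))).div_const 2)).pow 2).add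
      ((c4.pow 2).div ((c1.mul c2).const_mul 2) ?_)).const_mul lam).add (c3.div_const lam)
    exact fun s hs => mul_ne_zero two_ne_zero (mul_ne_zero (e1 s hs) (e2 s hs))
  set r := (b - t) / (t - a) with hr
  have hα : 0 < t - a := by linarith
  have hβ : 0 < b - t := by linarith
  -- This is where `t` being in the left half enters; it absorbs the error `f/β` below.
  have hr1 : 1 ≤ r := by rw [hr, le_div_iff₀ hα]; linarith
  have hr0 : 0 < r := by linarith
  set g : ℝ → ℝ := fun s => f s * √((b - s) / (s - a) / r) with hg
  have hgt : g t = f t := by simp [hg, hr, div_self (div_pos hβ hα).ne']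
  have hgc : g c = 0 := by simp [hg, hc]
  have hgd : ∀ s ∈ Icc t c, HasDerivAt g (√((b - s) / (s - a) / r) *
      (f' s - f s * (1 / (s - a) - 1 / (b - s)) / 2 - f s / (b - s))) s := fun s hs =>
    hasDerivAt_mul_sqrt_ratio (by linarith [hs.1]) (by linarith [hs.2]) hr0 (hf s)
  -- With the minus sign the endpoint difference is `|f t|^k`, so only an upper bound on the
  -- derivative is needed.
  have hhd : ∀ s ∈ Icc t c, HasDerivAt (fun s => -(|g s| ^ k)) _ s := fun s hs =>
    ((hasDerivAt_abs_rpow (g s) (by linarith : 1 < k)).comp s (hgd s hs)).neg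
  have key := intervalIntegral.sub_le_integral_of_hasDeriv_right_of_le (φ := fun s => k * W s) htc
    (fun s hs => (hhd s hs).continuousAt.continuousWithinAt)
    (fun s hs => (hhd s (Ioo_subset_Icc_self hs)).hasDerivWithinAt)
    ((hWc.const_smul k).integrableOn_Icc) ?_
  · rw [hgt, hgc, intervalIntegral.integral_const_mul] at key
    simpa [Real.zero_rpow (by linarith : k ≠ 0)] using key
  intro s hs
  have hαs : 0 < s - a := by linarith [hs.1]
  have hβs : 0 < b - s := by linarith [hs.2]
  have hρ : (b - s) / (s - a) / r ≤ 1 := by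
    rw [div_le_one hr0, hr]
    exact div_le_div₀ hβ.le (by linarith [hs.1]) hα (by linarith [hs.1])
  have hq1 : √((b - s) / (s - a) / r) ≤ 1 := Real.sqrt_le_one.2 hρ
  have hq0 := Real.sqrt_nonneg ((b - s) / (s - a) / r)
  -- Dropping `r ≥ 1` leaves `√(β/α)/β = 1/√(αβ)`, the size that the second term of the density
  -- controls.
  have hqβ : √((b - s) / (s - a) / r) / (b - s) ≤ 1 / √((s - a) * (b - s)) := by
    have h1 : √((b - s) / (s - a) / r) ≤ √((b - s) / (s - a)) :=
      Real.sqrt_le_sqrt (div_le_self (by positivity) hr1)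
    have h2 : √((b - s) / (s - a)) = (b - s) / √((s - a) * (b - s)) := by
      rw [Real.sqrt_div hβs.le, Real.sqrt_mul hαs.le]
      have := Real.sq_sqrt hβs.le
      have h3 := Real.sqrt_pos.2 hβs
      have h4 := Real.sqrt_pos.2 hαs
      field_simp
      linarith
    rw [div_le_iff₀ hβs]
    refine h1.trans (h2.trans ?_).le
    ring
  refine le_trans ?_ (mul_le_mul_of_nonneg_left
    (mul_add_le_hardyDensity hαs hβs hl (f s) (f' s)) (by linarith : 0 ≤ k))
  set q := √((b - s) / (s - a) / r) with hqdef
  set X := f' s - f s * (1 / (s - a) - 1 / (b - s)) / 2 with hX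
  have hgs : |g s| ≤ |f s| := by
    rw [hg, abs_mul, abs_of_nonneg hq0]
    exact mul_le_of_le_one_right (abs_nonneg _) hq1
  have hder : |g s| ^ (k - 2) * |g s| = |g s| ^ (k - 1) := by
    rw [← Real.rpow_add_one' (abs_nonneg _) (by linarith)]
    congr 1
    ring
  calc _ ≤ |-(k * |g s| ^ (k - 2) * g s * (q * (X - f s / (b - s))))| := le_abs_self _
    _ = k * (|g s| ^ (k - 1) * |q * (X - f s / (b - s))|) := by
        rw [abs_neg, abs_mul, abs_mul, abs_mul, abs_of_nonneg (by linarith : 0 ≤ k),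
          abs_of_nonneg (Real.rpow_nonneg (abs_nonneg (g s)) _), ← hder]
        ring
    _ ≤ k * (|f s| ^ (k - 1) * (|X| + |f s| / √((s - a) * (b - s)))) := by
        gcongr
        · linarith
        · rw [abs_mul, abs_of_nonneg hq0]
          calc q * |X - f s / (b - s)| ≤ q * (|X| + |f s| / (b - s)) := by
                gcongr
                refine (abs_sub _ _).trans ?_
                rw [abs_div, abs_of_pos hβs]
            _ = q * |X| + |f s| * (q / (b - s)) := by ring
            _ ≤ 1 * |X| + |f s| * (1 / √((s - a) * (b - s))) := by gcongr
            _ = _ := by ring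

lemma hardyDensity_nonneg {α β : ℝ} (h : 0 ≤ α * β) (y z : ℝ) : 0 ≤ hardyDensity α β y z := by
  unfold hardyDensity
  positivity

lemma abs_rpow_le_lintegral_of_left {a b t lam k : ℝ} (hk : 2 ≤ k) (hl : 0 < lam)
    (hat : a < t) (htb : t < b) (hmid : t - a ≤ b - t)
    {f f' : ℝ → ℝ} (hf : ∀ s, HasDerivAt f (f' s) s)
    (hf' : Continuous f') (hs : tsupport f ⊆ Ioo a b) :
    ENNReal.ofReal (|f t| ^ k) ≤ ENNReal.ofReal k * ∫⁻ s, ENNReal.ofReal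
      (lam * hardyDensity (s - a) (b - s) (f s) (f' s) + |f s| ^ (2 * k - 2) / lam) := by
  -- If `f` had no zero in `[t, b)`, the closed support would contain `b`.
  obtain ⟨c, htc, hcb, hfc⟩ : ∃ c, t ≤ c ∧ c < b ∧ f c = 0 := by
    by_contra! h
    have hsub : Ico t b ⊆ tsupport f := fun c hc => subset_tsupport f (h c hc.1 hc.2)
    have := closure_minimal hsub (isClosed_tsupport f)
    rw [closure_Ico htb.ne] at this
    exact absurd (hs (this (right_mem_Icc.2 htb.le))).2 (lt_irrefl b)
  have key := abs_rpow_le_integral_of_left hk hl hat htc hcb hmid hf hf' hfc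
  refine (ENNReal.ofReal_le_ofReal key).trans ?_
  rw [ENNReal.ofReal_mul (by linarith), intervalIntegral.integral_of_le htc]
  gcongr
  refine le_trans ?_ (setLIntegral_le_lintegral (Ioc t c) _)
  refine (Real.ofReal_le_enorm _).trans ((enorm_integral_le_lintegral_enorm _).trans_eq ?_)
  refine setLIntegral_congr_fun measurableSet_Ioc fun s hs => Real.enorm_of_nonneg ?_
  have := hardyDensity_nonneg
    (mul_nonneg (by linarith [hs.1] : 0 ≤ s - a) (by linarith [hs.2] : 0 ≤ b - s)) (f s) (f' s)
  positivity

/-- In the right half, reflect `s ↦ -s`, which exchanges the two ends. -/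
lemma abs_rpow_le_lintegral {a b t lam k : ℝ} (hk : 2 ≤ k) (hl : 0 < lam)
    (hat : a < t) (htb : t < b) {f f' : ℝ → ℝ} (hf : ∀ s, HasDerivAt f (f' s) s)
    (hf' : Continuous f') (hs : tsupport f ⊆ Ioo a b) :
    ENNReal.ofReal (|f t| ^ k) ≤ ENNReal.ofReal k * ∫⁻ s, ENNReal.ofReal
      (lam * hardyDensity (s - a) (b - s) (f s) (f' s) + |f s| ^ (2 * k - 2) / lam) := by
  rcases le_total (t - a) (b - t) with hmid | hmid
  · exact abs_rpow_le_lintegral_of_left hk hl hat htb hmid hf hf' hs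
  have hts : tsupport (fun s => f (-s)) = Neg.neg ⁻¹' tsupport f :=
    tsupport_comp_eq_preimage f (Homeomorph.neg ℝ)
  have h := abs_rpow_le_lintegral_of_left (a := -b) (b := -a) (t := -t) (f := fun s => f (-s))
    (f' := fun s => - f' (-s)) hk hl (by linarith) (by linarith) (by linarith)
    (fun s => ((hf (-s)).comp s (hasDerivAt_neg s)).congr_deriv (by ring)) (by fun_prop)
    (fun s hs' => by
      rw [hts] at hs'
      have := hs hs'
      exact ⟨by linarith [this.2], by linarith [this.1]⟩)
  rw [neg_neg] at h
  refine h.trans_eq ?_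
  rw [← lintegral_neg_eq_self]
  congr 1
  refine lintegral_congr fun s => ?_
  simp only [neg_neg]
  rw [hardyDensity_swap, neg_neg, show -a - -s = s - a by ring, show -s - -b = b - s by ring]

/-! ### Sections of a convex set by coordinate lines. -/

section Sections

variable {ι : Type*} [DecidableEq ι]

/-- The lower end of the section of `Ω` by the line through `x` in the direction `i`. -/
noncomputable def lowerEnd (Ω : Set (ι → ℝ)) (i : ι) (x : ι → ℝ) : ℝ :=
  sInf {t | Function.update x i t ∈ Ω}

/-- The upper end of the section of `Ω` by the line through `x` in the direction `i`. -/
noncomputable def upperEnd (Ω : Set (ι → ℝ)) (i : ι) (x : ι → ℝ) : ℝ :=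
  sSup {t | Function.update x i t ∈ Ω}

@[simp] lemma lowerEnd_update (Ω : Set (ι → ℝ)) (i : ι) (x : ι → ℝ) (t : ℝ) :
    lowerEnd Ω i (Function.update x i t) = lowerEnd Ω i x := by
  simp [lowerEnd]

@[simp] lemma upperEnd_update (Ω : Set (ι → ℝ)) (i : ι) (x : ι → ℝ) (t : ℝ) :
    upperEnd Ω i (Function.update x i t) = upperEnd Ω i x := by
  simp [upperEnd]

/-- The supremum exceeds `c` when the section has a point above `c`, and the set of such `x` is the
projection of an open set. -/
lemma measurable_sSup_section {X : Type*} [TopologicalSpace X] [MeasurableSpace X]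
    [OpensMeasurableSpace X] {S : Set (X × ℝ)} (hS : IsOpen S)
    (hb : ∀ x, BddAbove {t | (x, t) ∈ S}) : Measurable fun x => sSup {t | (x, t) ∈ S} := by
  have hU : ∀ T : Set ℝ, IsOpen T → IsOpen {x | ∃ t ∈ T, (x, t) ∈ S} := fun T hT => by
    convert isOpenMap_fst _ (hS.inter (hT.preimage continuous_snd)) using 1
    ext x
    simp [and_comm]
  refine measurable_of_Ioi fun c => ?_
  -- An empty section has `sSup ∅ = 0`, hence the extra piece when `c < 0`.
  have : (fun x => sSup {t | (x, t) ∈ S}) ⁻¹' Ioi c = {x | ∃ t ∈ Ioi c, (x, t) ∈ S} ∪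
      ({x | ∃ t ∈ univ, (x, t) ∈ S}ᶜ ∩ {_x | c < 0}) := by
    ext x
    by_cases hx : {t | (x, t) ∈ S}.Nonempty
    · have h2 : ∃ t, (x, t) ∈ S := hx
      simp only [mem_preimage, mem_Ioi, lt_csSup_iff (hb x) hx]
      simp [h2, and_comm]
    · have h1 := not_nonempty_iff_eq_empty.1 hx
      have h2 : ∀ t, (x, t) ∉ S := fun t ht => hx ⟨t, ht⟩
      simp [h2]
  rw [this]
  exact (hU _ isOpen_Ioi).measurableSet.union
    ((hU _ isOpen_univ).measurableSet.compl.inter (MeasurableSet.const _))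

variable {Ω : Set (ι → ℝ)}

lemma isBounded_section (hb : Bornology.IsBounded Ω) (i : ι) (x : ι → ℝ) :
    Bornology.IsBounded {t | Function.update x i t ∈ Ω} := by
  refine ((Bornology.forall_isBounded_image_eval_iff.2 hb) i).subset fun t ht => ?_
  exact ⟨_, ht, by simp⟩

lemma section_eq_Ioo (ho : IsOpen Ω) (hb : Bornology.IsBounded Ω) (hc : Convex ℝ Ω) (i : ι)
    {x : ι → ℝ} (hx : x ∈ Ω) :
    {t | Function.update x i t ∈ Ω} = Ioo (lowerEnd Ω i x) (upperEnd Ω i x) := by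
  have hbs := isBounded_section hb i x
  have hos : IsOpen {t | Function.update x i t ∈ Ω} :=
    ho.preimage (by fun_prop : Continuous fun t : ℝ => Function.update x i t)
  have hne : {t | Function.update x i t ∈ Ω}.Nonempty := ⟨x i, by simpa using hx⟩
  have hcs : Convex ℝ {t | Function.update x i t ∈ Ω} := by
    intro s hs t ht a b ha hb hab
    change Function.update x i (a • s + b • t) ∈ Ω
    convert hc hs ht ha hb hab using 1
    ext j
    by_cases hj : j = i
    · subst hj
      simp
    · simp [hj, ← add_mul, hab]
  refine Subset.antisymm ?_
    (IsConnected.Ioo_csInf_csSup_subset ⟨hne, hcs.isPreconnected⟩ hbs.bddBelow hbs.bddAbove)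
  rw [← hos.interior_eq]
  refine (interior_mono (subset_Icc_csInf_csSup hbs.bddBelow hbs.bddAbove)).trans ?_
  rw [interior_Icc]
  exact subset_rfl

/-- The distance to the lower end of the section in the direction `i`. -/
noncomputable def lowerGap (Ω : Set (ι → ℝ)) (i : ι) (x : ι → ℝ) : ℝ := x i - lowerEnd Ω i x

/-- The distance to the upper end of the section in the direction `i`. -/
noncomputable def upperGap (Ω : Set (ι → ℝ)) (i : ι) (x : ι → ℝ) : ℝ := upperEnd Ω i x - x i

variable [Fintype ι]

lemma measurable_upperEnd (ho : IsOpen Ω) (hb : Bornology.IsBounded Ω) (i : ι) :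
    Measurable (upperEnd Ω i) :=
  measurable_sSup_section
    (ho.preimage (by fun_prop : Continuous fun p : (ι → ℝ) × ℝ => Function.update p.1 i p.2))
    fun x => (isBounded_section hb i x).bddAbove

lemma measurable_lowerEnd (ho : IsOpen Ω) (hb : Bornology.IsBounded Ω) (i : ι) :
    Measurable (lowerEnd Ω i) := by
  have h := measurable_sSup_section
    (ho.preimage (by fun_prop : Continuous fun p : (ι → ℝ) × ℝ => Function.update p.1 i (-p.2)))
    fun x => (isBounded_section hb i x).bddBelow.neg
  have h2 : lowerEnd Ω i = fun x => - sSup {t | (x, t) ∈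
      (fun p : (ι → ℝ) × ℝ => Function.update p.1 i (-p.2)) ⁻¹' Ω} := by
    ext x
    rw [lowerEnd, Real.sInf_def]
    rfl
  rw [h2]
  exact h.neg

/-- A uniform gap on a compact set makes the Hardy weights bounded on the support, which gives
integrability. -/
lemma exists_le_end_sub (ho : IsOpen Ω) (hb : Bornology.IsBounded Ω) {K : Set (ι → ℝ)}
    (hK : IsCompact K) (hKΩ : K ⊆ Ω) :
    ∃ ε, 0 < ε ∧ ∀ x ∈ K, ∀ i, ε ≤ x i - lowerEnd Ω i x ∧ ε ≤ upperEnd Ω i x - x i := by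
  obtain ⟨δ, hδ, hsub⟩ := hK.exists_thickening_subset_open ho hKΩ
  have hmem : ∀ x ∈ K, ∀ i, ∀ t, |t - x i| < δ → Function.update x i t ∈ Ω := by
    intro x hx i t ht
    refine hsub (Metric.mem_thickening_iff.2 ⟨x, hx, ?_⟩)
    rw [dist_pi_lt_iff hδ]
    intro j
    by_cases hj : j = i
    · subst hj
      simpa [Real.dist_eq] using ht
    · simpa [hj] using hδ
  refine ⟨δ / 2, by positivity, fun x hx i => ?_⟩
  have h1 := hmem x hx i (x i - δ / 2) (by rw [abs_lt]; constructor <;> linarith)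
  have h2 := hmem x hx i (x i + δ / 2) (by rw [abs_lt]; constructor <;> linarith)
  have hbs := isBounded_section hb i x
  have h3 : lowerEnd Ω i x ≤ x i - δ / 2 := csInf_le hbs.bddBelow h1
  have h4 : x i + δ / 2 ≤ upperEnd Ω i x := le_csSup hbs.bddAbove h2
  constructor <;> linarith

lemma measurable_lowerGap (ho : IsOpen Ω) (hb : Bornology.IsBounded Ω) (i : ι) :
    Measurable (lowerGap Ω i) :=
  (measurable_pi_apply i).sub (measurable_lowerEnd ho hb i)

lemma measurable_upperGap (ho : IsOpen Ω) (hb : Bornology.IsBounded Ω) (i : ι) :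
    Measurable (upperGap Ω i) :=
  (measurable_upperEnd ho hb i).sub (measurable_pi_apply i)

lemma lowerGap_pos (ho : IsOpen Ω) (hb : Bornology.IsBounded Ω) (i : ι) {x : ι → ℝ}
    (hx : x ∈ Ω) : 0 < lowerGap Ω i x := by
  obtain ⟨ε, hε, h⟩ := exists_le_end_sub ho hb isCompact_singleton (singleton_subset_iff.2 hx)
  exact hε.trans_le (h x rfl i).1

lemma upperGap_pos (ho : IsOpen Ω) (hb : Bornology.IsBounded Ω) (i : ι) {x : ι → ℝ}
    (hx : x ∈ Ω) : 0 < upperGap Ω i x := by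
  obtain ⟨ε, hε, h⟩ := exists_le_end_sub ho hb isCompact_singleton (singleton_subset_iff.2 hx)
  exact hε.trans_le (h x rfl i).2

end Sections

/-! ### Partial derivatives and directional remainders. -/

section Derivatives

variable {ι : Type*} [DecidableEq ι] {Ω : Set (ι → ℝ)} {u : (ι → ℝ) → ℝ}

/-- The `i`-th partial derivative. -/
noncomputable def partialDeriv (u : (ι → ℝ) → ℝ) (i : ι) (x : ι → ℝ) : ℝ :=
  fderiv ℝ u x (Pi.single i 1)

lemma partialDeriv_eq_zero {i : ι} {x : ι → ℝ} (hx : x ∉ tsupport u) : partialDeriv u i x = 0 := by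
  have : fderiv ℝ u x = 0 := by
    by_contra h
    exact hx (support_fderiv_subset ℝ h)
  simp [partialDeriv, this]

/-- The Hardy remainder density in the direction `i`. -/
noncomputable def directionalDensity (Ω : Set (ι → ℝ)) (u : (ι → ℝ) → ℝ) (i : ι) (x : ι → ℝ) : ℝ :=
  hardyDensity (lowerGap Ω i x) (upperGap Ω i x) (u x) (partialDeriv u i x)

lemma directionalDensity_eq_zero {i : ι} {x : ι → ℝ} (hx : x ∉ tsupport u) :
    directionalDensity Ω u i x = 0 := by
  simp [directionalDensity, hardyDensity, partialDeriv_eq_zero hx, image_eq_zero_of_notMem_tsupport hx]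

lemma tsupport_comp_update_subset (hs : tsupport u ⊆ Ω) (ho : IsOpen Ω)
    (hb : Bornology.IsBounded Ω) (hc : Convex ℝ Ω) (i : ι) {x : ι → ℝ} (hx : x ∈ Ω) :
    tsupport (fun s => u (Function.update x i s)) ⊆ Ioo (lowerEnd Ω i x) (upperEnd Ω i x) := by
  rw [← section_eq_Ioo ho hb hc i hx]
  exact (tsupport_comp_subset_preimage u
    (by fun_prop : Continuous fun t : ℝ => Function.update x i t)).trans (preimage_mono hs)

variable [Fintype ι]

lemma continuous_partialDeriv (hu : ContDiff ℝ 1 u) (i : ι) : Continuous (partialDeriv u i) :=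
  (hu.continuous_fderiv one_ne_zero).clm_apply continuous_const

lemma hasDerivAt_comp_update (hu : ContDiff ℝ 1 u) (i : ι) (x : ι → ℝ) (s : ℝ) :
    HasDerivAt (fun s => u (Function.update x i s)) (partialDeriv u i (Function.update x i s)) s :=
  ((hu.differentiable one_ne_zero _).hasFDerivAt).comp_hasDerivAt s (hasDerivAt_update x i s)

lemma directionalDensity_nonneg (ho : IsOpen Ω) (hb : Bornology.IsBounded Ω)
    (hs : tsupport u ⊆ Ω) (i : ι) (x : ι → ℝ) : 0 ≤ directionalDensity Ω u i x := by
  by_cases hx : x ∈ tsupport u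
  · exact hardyDensity_nonneg
      (mul_pos (lowerGap_pos ho hb i (hs hx)) (upperGap_pos ho hb i (hs hx))).le _ _
  · exact (directionalDensity_eq_zero hx).ge

lemma measurable_directionalDensity (ho : IsOpen Ω) (hb : Bornology.IsBounded Ω)
    (hu : ContDiff ℝ 1 u) (i : ι) : Measurable (directionalDensity Ω u i) := by
  have h1 := measurable_lowerGap ho hb i
  have h2 := measurable_upperGap ho hb i
  have h3 := hu.continuous.measurable
  have h4 := (continuous_partialDeriv hu i).measurable
  unfold directionalDensity hardyDensity
  fun_prop

lemma abs_rpow_le_lintegral_line {lam k : ℝ} (hk : 2 ≤ k) (hl : 0 < lam) (ho : IsOpen Ω)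
    (hb : Bornology.IsBounded Ω) (hc : Convex ℝ Ω) (hu : ContDiff ℝ 1 u) (hs : tsupport u ⊆ Ω)
    (i : ι) (x : ι → ℝ) :
    ENNReal.ofReal (|u x| ^ k) ≤ ENNReal.ofReal k * ∫⁻ s, ENNReal.ofReal
      (lam * directionalDensity Ω u i (Function.update x i s) +
        |u (Function.update x i s)| ^ (2 * k - 2) / lam) := by
  by_cases hx : x ∈ tsupport u
  swap
  · simp [image_eq_zero_of_notMem_tsupport hx, Real.zero_rpow (by linarith : k ≠ 0)]
  have hxΩ := hs hx
  have h1 := lowerGap_pos ho hb i hxΩ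
  have h2 := upperGap_pos ho hb i hxΩ
  have h := abs_rpow_le_lintegral (t := x i) hk hl (sub_pos.1 h1) (sub_pos.1 h2)
    (hasDerivAt_comp_update hu i x) ((continuous_partialDeriv hu i).comp (by fun_prop))
    (tsupport_comp_update_subset hs ho hb hc i hxΩ)
  simpa [directionalDensity, lowerGap, upperGap] using h

end Derivatives

/-! ### Integrating the remainder: the flux term vanishes. -/

lemma continuous_mul_of_tsupport_subset {X : Type*} [TopologicalSpace X] {f m : X → ℝ} {U : Set X}
    (hf : Continuous f) (hm : ContinuousOn m U) (hU : IsOpen U) (hs : tsupport f ⊆ U) :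
    Continuous fun x => f x * m x :=
  (hf.continuousOn.mul hm).continuous_of_tsupport_subset hU
    ((tsupport_mul_subset_left (f := f) (g := m)).trans hs)

lemma integrable_mul_of_bounded_on_tsupport {X : Type*} [TopologicalSpace X] [MeasurableSpace X]
    [OpensMeasurableSpace X] {μ : Measure X} [IsFiniteMeasureOnCompacts μ] {f m : X → ℝ} {C : ℝ}
    (hf : Continuous f) (hc : HasCompactSupport f) (hm : Measurable m)
    (hC : ∀ x ∈ tsupport f, |m x| ≤ C) : Integrable (fun x => f x * m x) μ := by
  have hT := (isClosed_tsupport f).measurableSet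
  -- The weight is bounded only on the support of `f`, so it is cut off there without changing the
  -- product.
  have h : (fun x => f x * m x) = fun x => f x * (tsupport f).indicator m x := by
    ext x
    by_cases hx : x ∈ tsupport f
    · rw [indicator_of_mem hx]
    · simp [image_eq_zero_of_notMem_tsupport hx]
  rw [h]
  refine (hf.integrable_of_hasCompactSupport hc).mul_bdd (c := |C|) (hm.indicator hT).aestronglyMeasurable
    (Filter.Eventually.of_forall fun x => ?_)
  by_cases hx : x ∈ tsupport f
  · rw [indicator_of_mem hx]
    exact (hC x hx).trans (le_abs_self C)
  · simp [indicator_of_notMem hx]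

/-- The integrand is the derivative of `f²(1/α - 1/β)/2`, which is compactly supported in `(a, b)`.
-/
lemma integral_hardyFlux_eq_zero {a b : ℝ} {f f' : ℝ → ℝ} (hf : ∀ s, HasDerivAt f (f' s) s)
    (hf' : Continuous f') (hs : tsupport f ⊆ Ioo a b) :
    ∫ s, f s * (f' s * (1 / (s - a) - 1 / (b - s)) -
      f s * (1 / (s - a) ^ 2 + 1 / (b - s) ^ 2) / 2) = 0 := by
  have hfc : Continuous f := continuous_iff_continuousAt.2 fun s => (hf s).continuousAt
  have hc : HasCompactSupport f :=
    Metric.isCompact_of_isClosed_isBounded (isClosed_tsupport f) (Metric.isBounded_Ioo a b |>.subset hs)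
  have e1 : ∀ s ∈ Ioo a b, s - a ≠ 0 := fun s hs => (sub_pos.2 hs.1).ne'
  have e2 : ∀ s ∈ Ioo a b, b - s ≠ 0 := fun s hs => (sub_pos.2 hs.2).ne'
  have c1 : ContinuousOn (fun s => 1 / (s - a)) (Ioo a b) :=
    continuousOn_const.div (by fun_prop) e1
  have c2 : ContinuousOn (fun s => 1 / (b - s)) (Ioo a b) :=
    continuousOn_const.div (by fun_prop) e2
  have c3 : ContinuousOn (fun s => 1 / (s - a) ^ 2) (Ioo a b) :=
    continuousOn_const.div (by fun_prop) fun s hs => pow_ne_zero 2 (e1 s hs)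
  have c4 : ContinuousOn (fun s => 1 / (b - s) ^ 2) (Ioo a b) :=
    continuousOn_const.div (by fun_prop) fun s hs => pow_ne_zero 2 (e2 s hs)
  refine integral_eq_zero_of_hasDerivAt_of_integrable
    (f := fun s => f s * (f s * (1 / (s - a) - 1 / (b - s)) / 2)) (fun s => ?_) ?_ ?_
  · by_cases hst : s ∈ tsupport f
    · have h1 : HasDerivAt (fun s => 1 / (s - a)) _ s :=
        (hasDerivAt_const s (1 : ℝ)).div ((hasDerivAt_id s).sub_const a) (e1 s (hs hst))
      have h2 : HasDerivAt (fun s => 1 / (b - s)) _ s :=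
        (hasDerivAt_const s (1 : ℝ)).div ((hasDerivAt_id s).const_sub b) (e2 s (hs hst))
      refine ((hf s).mul (((hf s).mul (h1.sub h2)).div_const 2)).congr_deriv ?_
      simp only [Pi.sub_apply, Pi.mul_apply]
      ring
    · have h0 : f s = 0 := image_eq_zero_of_notMem_tsupport hst
      have hev := notMem_tsupport_iff_eventuallyEq.1 hst
      rw [h0, zero_mul]
      refine (hasDerivAt_const s (0 : ℝ)).congr_of_eventuallyEq ?_
      filter_upwards [hev] with r hr
      simp [hr]
  · refine (continuous_mul_of_tsupport_subset hfc ?_ isOpen_Ioo hs).integrable_of_hasCompactSupport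
      hc.mul_right
    exact (hf'.continuousOn.mul (c1.sub c2)).sub ((hfc.continuousOn.mul (c3.add c4)).div_const 2)
  · refine (continuous_mul_of_tsupport_subset hfc ?_ isOpen_Ioo hs).integrable_of_hasCompactSupport
      hc.mul_right
    exact (hfc.continuousOn.mul (c1.sub c2)).div_const 2

lemma integral_eq_zero_of_line_integrals {n : ℕ} {φ : (Fin (n + 1) → ℝ) → ℝ} (hφ : Integrable φ)
    (i : Fin (n + 1)) (h : ∀ y, ∫ s, φ (Function.update y i s) = 0) : ∫ x, φ x = 0 := by
  have hmp := (volume_preserving_piFinSuccAbove (fun _ : Fin (n + 1) => ℝ) i).symm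
  rw [← hmp.integral_comp' φ]
  have hint := (hmp.integrable_comp_emb (MeasurableEquiv.measurableEmbedding _)).2 hφ
  rw [Measure.volume_eq_prod] at hint ⊢
  refine (integral_prod_symm _ hint).trans ?_
  refine integral_eq_zero_of_ae (Filter.Eventually.of_forall fun y => ?_)
  refine Eq.trans ?_ (h (i.insertNth 0 y))
  refine integral_congr_ae (Filter.Eventually.of_forall fun s => ?_)
  change φ (i.insertNth s y) = φ (Function.update (i.insertNth 0 y) i s)
  rw [Fin.update_insertNth]

section Density

variable {ι : Type*} [DecidableEq ι] {Ω : Set (ι → ℝ)} {u : (ι → ℝ) → ℝ}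

lemma hasCompactSupport_partialDeriv (hu : HasCompactSupport u) (i : ι) :
    HasCompactSupport (partialDeriv u i) :=
  hu.mono' fun x hx => by
    by_contra h
    exact hx (partialDeriv_eq_zero h)

variable [Fintype ι]

/-- Separates the energy density from a total derivative along the line; the `y²/(2αβ)` term cancels
the cross term of the squared weight. -/
lemma directionalDensity_eq (ho : IsOpen Ω) (hb : Bornology.IsBounded Ω) (hs : tsupport u ⊆ Ω)
    (i : ι) (x : ι → ℝ) : directionalDensity Ω u i x =
      (partialDeriv u i x ^ 2 - u x ^ 2 * (1 / lowerGap Ω i x ^ 2 + 1 / upperGap Ω i x ^ 2) / 4) -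
      u x * (partialDeriv u i x * (1 / lowerGap Ω i x - 1 / upperGap Ω i x) -
        u x * (1 / lowerGap Ω i x ^ 2 + 1 / upperGap Ω i x ^ 2) / 2) := by
  by_cases hx : x ∈ tsupport u
  · have h1 := (lowerGap_pos ho hb i (hs hx)).ne'
    have h2 := (upperGap_pos ho hb i (hs hx)).ne'
    unfold directionalDensity hardyDensity
    field_simp
    ring
  · simp [directionalDensity_eq_zero hx, partialDeriv_eq_zero hx,
      image_eq_zero_of_notMem_tsupport hx]

lemma integrable_sq_mul_gaps (ho : IsOpen Ω) (hb : Bornology.IsBounded Ω) (hu : Continuous u)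
    (hcs : HasCompactSupport u) (hs : tsupport u ⊆ Ω) (i : ι) :
    Integrable fun x => u x ^ 2 * (1 / lowerGap Ω i x ^ 2 + 1 / upperGap Ω i x ^ 2) := by
  obtain ⟨ε, hε, h⟩ := exists_le_end_sub ho hb hcs hs
  have h1 := measurable_lowerGap ho hb i
  have h2 := measurable_upperGap ho hb i
  have hsub : tsupport (fun x => u x ^ 2) ⊆ tsupport u := closure_mono fun x hx hx0 => hx (by simp [hx0])
  refine integrable_mul_of_bounded_on_tsupport (C := 1 / ε ^ 2 + 1 / ε ^ 2) (by fun_prop)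
    (hcs.mono fun x hx hx0 => hx (by simp [hx0])) (by fun_prop) fun x hx => ?_
  obtain ⟨ha, hb⟩ := h x (hsub hx) i
  rw [abs_of_nonneg (by positivity)]
  change ε ≤ lowerGap Ω i x at ha
  change ε ≤ upperGap Ω i x at hb
  gcongr

lemma integrable_hardyFlux (ho : IsOpen Ω) (hb : Bornology.IsBounded Ω) (hu : ContDiff ℝ 1 u)
    (hcs : HasCompactSupport u) (hs : tsupport u ⊆ Ω) (i : ι) :
    Integrable fun x => u x * (partialDeriv u i x * (1 / lowerGap Ω i x - 1 / upperGap Ω i x) -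
        u x * (1 / lowerGap Ω i x ^ 2 + 1 / upperGap Ω i x ^ 2) / 2) := by
  obtain ⟨ε, hε, h⟩ := exists_le_end_sub ho hb hcs hs
  have h1 := measurable_lowerGap ho hb i
  have h2 := measurable_upperGap ho hb i
  have huc := hu.continuous
  have hD := continuous_partialDeriv hu i
  have key : Integrable fun x => (u x * partialDeriv u i x) *
      (1 / lowerGap Ω i x - 1 / upperGap Ω i x) := by
    have hsub : tsupport (fun x => u x * partialDeriv u i x) ⊆ tsupport u :=
      tsupport_mul_subset_left
    refine integrable_mul_of_bounded_on_tsupport (C := 1 / ε + 1 / ε) (by fun_prop)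
      hcs.mul_right (by fun_prop) fun x hx => ?_
    obtain ⟨ha, hb⟩ := h x (hsub hx) i
    change ε ≤ lowerGap Ω i x at ha
    change ε ≤ upperGap Ω i x at hb
    refine (abs_sub _ _).trans ?_
    rw [abs_of_nonneg (one_div_nonneg.2 (hε.le.trans ha)),
      abs_of_nonneg (one_div_nonneg.2 (hε.le.trans hb))]
    gcongr
  refine (key.sub ((integrable_sq_mul_gaps ho hb huc hcs hs i).div_const 2)).congr
    (Filter.Eventually.of_forall fun x => ?_)
  simp only [Pi.sub_apply]
  ring

lemma integrable_directional_energy (ho : IsOpen Ω) (hb : Bornology.IsBounded Ω)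
    (hu : ContDiff ℝ 1 u) (hcs : HasCompactSupport u) (hs : tsupport u ⊆ Ω) (i : ι) :
    Integrable fun x => partialDeriv u i x ^ 2 -
      u x ^ 2 * (1 / lowerGap Ω i x ^ 2 + 1 / upperGap Ω i x ^ 2) / 4 := by
  refine Integrable.sub ?_ ((integrable_sq_mul_gaps ho hb hu.continuous hcs hs i).div_const 4)
  exact ((continuous_partialDeriv hu i).pow 2).integrable_of_hasCompactSupport
    ((hasCompactSupport_partialDeriv hcs i).mono fun x hx hx0 => hx (by simp [hx0]))

lemma integrable_directionalDensity (ho : IsOpen Ω) (hb : Bornology.IsBounded Ω)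
    (hu : ContDiff ℝ 1 u) (hcs : HasCompactSupport u) (hs : tsupport u ⊆ Ω) (i : ι) :
    Integrable (directionalDensity Ω u i) :=
  ((integrable_directional_energy ho hb hu hcs hs i).sub
    (integrable_hardyFlux ho hb hu hcs hs i)).congr
    (Filter.Eventually.of_forall fun x => (directionalDensity_eq ho hb hs i x).symm)

end Density

lemma integral_directionalDensity {n : ℕ} {Ω : Set (Fin (n + 1) → ℝ)} {u : (Fin (n + 1) → ℝ) → ℝ}
    (ho : IsOpen Ω) (hb : Bornology.IsBounded Ω) (hc : Convex ℝ Ω)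
    (hu : ContDiff ℝ 1 u) (hcs : HasCompactSupport u) (hs : tsupport u ⊆ Ω) (i : Fin (n + 1)) :
    ∫ x, directionalDensity Ω u i x = ∫ x, (partialDeriv u i x ^ 2 -
      u x ^ 2 * (1 / lowerGap Ω i x ^ 2 + 1 / upperGap Ω i x ^ 2) / 4) := by
  simp_rw [directionalDensity_eq ho hb hs]
  rw [integral_sub (integrable_directional_energy ho hb hu hcs hs i)
    (integrable_hardyFlux ho hb hu hcs hs i), sub_eq_self]
  refine integral_eq_zero_of_line_integrals (integrable_hardyFlux ho hb hu hcs hs i) i fun y => ?_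
  by_cases hy : ∃ s, Function.update y i s ∈ tsupport u
  · obtain ⟨s₀, hs₀⟩ := hy
    have h := integral_hardyFlux_eq_zero (hasDerivAt_comp_update hu i (Function.update y i s₀))
      ((continuous_partialDeriv hu i).comp (by fun_prop))
      (tsupport_comp_update_subset hs ho hb hc i (hs hs₀))
    simpa [lowerGap, upperGap] using h
  · push Not at hy
    simp [image_eq_zero_of_notMem_tsupport (hy _)]

/-! ### Optimising the parameter and interpolating norms. -/

lemma sq_le_four_mul_of_forall_le {X a b : ℝ} (hX : 0 ≤ X) (ha : 0 ≤ a) (hb : 0 ≤ b)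
    (h : ∀ lam : ℝ, 0 < lam → X ≤ lam * a + b / lam) : X ^ 2 ≤ 4 * a * b := by
  -- For `x > 0` the hypothesis times `x` says that `a x² - X x + b ≥ 0`; for `x ≤ 0` each term is
  -- nonnegative. So the discriminant is at most zero.
  have := discrim_le_zero (a := a) (b := -X) (c := b) fun x => ?_
  · unfold discrim at this
    linarith
  rcases le_or_gt x 0 with hx | hx
  · nlinarith [mul_nonneg hX (neg_nonneg.2 hx), mul_nonneg ha (mul_self_nonneg x)]
  · have h1 := mul_le_mul_of_nonneg_right (h x hx) hx.le
    have h2 : (x * a + b / x) * x = a * (x * x) + b := by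
      field_simp
    linarith

lemma integrable_abs_rpow {X : Type*} [TopologicalSpace X] [MeasurableSpace X]
    [OpensMeasurableSpace X] {μ : Measure X} [IsFiniteMeasureOnCompacts μ] {u : X → ℝ}
    (hu : Continuous u) (hcs : HasCompactSupport u) {p : ℝ} (hp : 0 < p) :
    Integrable (fun x => |u x| ^ p) μ :=
  (hu.abs.rpow_const fun _ => Or.inr hp.le).integrable_of_hasCompactSupport
    (hcs.mono fun x hx hx0 => hx (by simp [hx0, Real.zero_rpow hp.ne']))

/-- Hölder's inequality for `|u|^q = (|u|^r)^(1-θ) * (|u|^p)^θ`. -/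
lemma integral_rpow_le_of_interpolation {X : Type*} [TopologicalSpace X] [MeasurableSpace X]
    [OpensMeasurableSpace X] {μ : Measure X} [IsFiniteMeasureOnCompacts μ] {u : X → ℝ}
    (hu : Continuous u) (hcs : HasCompactSupport u) {p q r θ : ℝ} (hp : 0 < p) (hr : 0 < r)
    (hθ : 0 ≤ θ) (hθ1 : θ ≤ 1) (hq : q = (1 - θ) * r + θ * p) :
    ∫ x, |u x| ^ q ∂μ ≤ (∫ x, |u x| ^ r ∂μ) ^ (1 - θ) * (∫ x, |u x| ^ p ∂μ) ^ θ := by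
  have hq0 : 0 < q := by
    rw [hq]
    rcases hθ.eq_or_lt with h | h
    · simpa [← h] using hr
    · have := mul_pos h hp
      nlinarith [mul_nonneg (sub_nonneg.2 hθ1) hr.le]
  have conv : ∀ s : ℝ, 0 < s → ENNReal.ofReal (∫ x, |u x| ^ s ∂μ) =
      ∫⁻ x, ENNReal.ofReal (|u x| ^ s) ∂μ := fun s hs =>
    ofReal_integral_eq_lintegral_ofReal (integrable_abs_rpow hu hcs hs)
      (Filter.Eventually.of_forall fun x => by positivity)
  have hm : ∀ s : ℝ, AEMeasurable (fun x => ENNReal.ofReal (|u x| ^ s)) μ := fun s =>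
    ((hu.measurable.abs.pow_const s).ennreal_ofReal).aemeasurable
  have hI : ∀ s : ℝ, 0 ≤ ∫ x, |u x| ^ s ∂μ := fun s => integral_nonneg fun x => by positivity
  rw [← ENNReal.ofReal_le_ofReal_iff (by have := hI r; have := hI p; positivity),
    ENNReal.ofReal_mul (Real.rpow_nonneg (hI r) _),
    ← ENNReal.ofReal_rpow_of_nonneg (hI r) (by linarith),
    ← ENNReal.ofReal_rpow_of_nonneg (hI p) hθ, conv q hq0, conv r hr, conv p hp]
  refine le_trans (le_of_eq (lintegral_congr fun x => ?_))
    (ENNReal.lintegral_mul_norm_pow_le (hm r) (hm p) (by linarith) hθ (by ring))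
  rw [ENNReal.ofReal_rpow_of_nonneg (by positivity) (by linarith),
    ENNReal.ofReal_rpow_of_nonneg (by positivity) hθ, ← ENNReal.ofReal_mul (by positivity),
    ← Real.rpow_mul (abs_nonneg _), ← Real.rpow_mul (abs_nonneg _),
    ← Real.rpow_add_of_nonneg (abs_nonneg _) (mul_nonneg hr.le (by linarith))
      (mul_nonneg hp.le hθ), hq]
  congr 2
  ring

/-! ### Combining the coordinate directions. -/

section GridLines

variable {n : ℕ} {Ω : Set (Fin (n + 1) → ℝ)} {u : (Fin (n + 1) → ℝ) → ℝ}

/-- The sum of the Hardy remainder densities over all coordinate directions. -/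
noncomputable def totalDensity (Ω : Set (Fin (n + 1) → ℝ)) (u : (Fin (n + 1) → ℝ) → ℝ)
    (x : Fin (n + 1) → ℝ) : ℝ := ∑ i, directionalDensity Ω u i x

/-- One function `G` must dominate in every direction, so the summed density is used; nonnegativity
of the summands allows this. The grid-lines inequality then applies to `G`. -/
lemma integral_rpow_le_weighted (hn : 1 ≤ n) {N k lam : ℝ} (hN : N = n + 1) (hk : 2 ≤ k)
    (hl : 0 < lam) (ho : IsOpen Ω)
    (hb : Bornology.IsBounded Ω) (hc : Convex ℝ Ω) (hu : ContDiff ℝ 1 u)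
    (hcs : HasCompactSupport u) (hs : tsupport u ⊆ Ω) :
    ∫ x, |u x| ^ (k * (N / (N - 1))) ≤
      (k * (lam * (∫ x, totalDensity Ω u x) + (∫ x, |u x| ^ (2 * k - 2)) / lam)) ^ (N / (N - 1)) := by
  have hn' : (1 : ℝ) ≤ n := by exact_mod_cast hn
  have hN1 : 0 < N - 1 := by rw [hN]; linarith
  have hN0 : 0 < N := by linarith
  have hk0 : 0 ≤ k := by linarith
  have hF0 : ∀ x, 0 ≤ totalDensity Ω u x := fun x =>
    Finset.sum_nonneg fun i _ => directionalDensity_nonneg ho hb hs i x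
  have hFi : Integrable (totalDensity Ω u) :=
    integrable_finsetSum _ fun i _ => integrable_directionalDensity ho hb hu hcs hs i
  have hFm : Measurable (totalDensity Ω u) :=
    Finset.measurable_sum _ fun i _ => measurable_directionalDensity ho hb hu i
  have hQi := integrable_abs_rpow (μ := volume) hu.continuous hcs (by linarith : 0 < 2 * k - 2)
  set G : (Fin (n + 1) → ℝ) → ℝ := fun x =>
    k * (lam * totalDensity Ω u x + |u x| ^ (2 * k - 2) / lam) with hG
  have hG0 : ∀ x, 0 ≤ G x := fun x => by have := hF0 x; positivity
  have hGi : Integrable G := ((hFi.const_mul lam).add (hQi.div_const lam)).const_mul k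
  have hGm : Measurable G := by
    have := hu.continuous.measurable
    fun_prop
  have hGI : ∫ x, G x = k * (lam * (∫ x, totalDensity Ω u x) + (∫ x, |u x| ^ (2 * k - 2)) / lam) := by
    rw [integral_const_mul, integral_add (hFi.const_mul lam) (hQi.div_const lam),
      integral_const_mul, integral_div]
  have hline : ∀ x i, ENNReal.ofReal (|u x| ^ k) ≤
      ∫⁻ s, ENNReal.ofReal (G (Function.update x i s)) := fun x i => by
    refine (abs_rpow_le_lintegral_line hk hl ho hb hc hu hs i x).trans ?_
    rw [← lintegral_const_mul' _ _ ENNReal.ofReal_ne_top]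
    refine lintegral_mono fun s => ?_
    rw [← ENNReal.ofReal_mul hk0]
    refine ENNReal.ofReal_le_ofReal ?_
    simp only [hG]
    gcongr
    exact Finset.single_le_sum (f := fun j => directionalDensity Ω u j (Function.update x i s))
      (fun j _ => directionalDensity_nonneg ho hb hs j _) (Finset.mem_univ i)
  have hconj : (Fintype.card (Fin (n + 1)) : ℝ).HolderConjugate (N / (N - 1)) := by
    rw [Fintype.card_fin]
    push_cast
    rw [← hN, Real.holderConjugate_iff]
    refine ⟨by linarith, ?_⟩
    field_simp
    ring
  have hLW := lintegral_prod_lintegral_pow_le (fun _ : Fin (n + 1) => (volume : Measure ℝ)) hconj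
    hGm.ennreal_ofReal
  rw [← volume_pi, ← ofReal_integral_eq_lintegral_ofReal hGi (Filter.Eventually.of_forall hG0), hGI,
    ENNReal.ofReal_rpow_of_nonneg (by rw [← hGI]; exact integral_nonneg hG0) (by positivity)] at hLW
  rw [← ENNReal.ofReal_le_ofReal_iff (Real.rpow_nonneg (by rw [← hGI]; exact integral_nonneg hG0) _),
    ofReal_integral_eq_lintegral_ofReal (integrable_abs_rpow hu.continuous hcs (by positivity))
      (Filter.Eventually.of_forall fun x => by positivity)]
  refine le_trans (lintegral_mono fun x => ?_) hLW
  -- `N` equal factors with exponent `1/(N - 1)`, one for each direction.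
  have hprod : ENNReal.ofReal (|u x| ^ (k * (N / (N - 1)))) =
      ∏ _i : Fin (n + 1), ENNReal.ofReal (|u x| ^ k) ^
        ((1 : ℝ) / ((Fintype.card (Fin (n + 1)) : ℝ) - 1)) := by
    rw [Finset.prod_const, Finset.card_univ, Fintype.card_fin]
    push_cast
    rw [← hN, ENNReal.ofReal_rpow_of_nonneg (by positivity) (by positivity),
      ← ENNReal.ofReal_pow (by positivity), ← Real.rpow_mul (abs_nonneg _), ← Real.rpow_natCast,
      ← Real.rpow_mul (abs_nonneg _)]
    congr 2
    push_cast
    rw [← hN]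
    ring
  rw [hprod]
  refine Finset.prod_le_prod' fun i _ => ?_
  refine ENNReal.rpow_le_rpow (hline x i) ?_
  rw [Fintype.card_fin]
  push_cast
  rw [← hN]
  positivity

lemma exists_const_integral_rpow_le (hn : 1 ≤ n) {N : ℝ} (hN : N = n + 1) : ∃ C : ℝ, 0 < C ∧
    ∀ (Ω : Set (Fin (n + 1) → ℝ)) (u : (Fin (n + 1) → ℝ) → ℝ), IsOpen Ω → Bornology.IsBounded Ω →
      Convex ℝ Ω → ContDiff ℝ 1 u → HasCompactSupport u → tsupport u ⊆ Ω →
      ∫ x, |u x| ^ (2 * (1 + 2 / N)) ≤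
        C * (∫ x, totalDensity Ω u x) * (∫ x, u x ^ 2) ^ (2 / N) := by
  have hn' : (1 : ℝ) ≤ n := by exact_mod_cast hn
  have hN2 : 2 ≤ N := by rw [hN]; linarith
  have hN0 : 0 < N := by linarith
  have hN1 : 0 < N - 1 := by linarith
  -- Chosen so that `k * N/(N - 1)` is the target exponent `2(1 + 2/N)`; `k ≥ 2` amounts to `N ≥ 2`.
  set k := 2 * (N + 2) * (N - 1) / N ^ 2 with hkdef
  have hk : 2 ≤ k := by
    rw [hkdef, le_div_iff₀ (by positivity)]
    nlinarith
  have hk0 : 0 < k := by linarith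
  have hp : 2 * (1 + 2 / N) = k * (N / (N - 1)) := by
    rw [hkdef]
    field_simp
  refine ⟨4 * k ^ 2, by positivity, fun Ω u ho hb hc hu hcs hs => ?_⟩
  set F := ∫ x, totalDensity Ω u x with hF
  set P := ∫ x, |u x| ^ (2 * (1 + 2 / N)) with hP
  set Q := ∫ x, |u x| ^ (2 * k - 2) with hQ
  set M := ∫ x, u x ^ 2 with hM
  have hF0 : 0 ≤ F := integral_nonneg fun x =>
    Finset.sum_nonneg fun i _ => directionalDensity_nonneg ho hb hs i x
  have hP0 : 0 ≤ P := integral_nonneg fun x => by positivity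
  have hQ0 : 0 ≤ Q := integral_nonneg fun x => by positivity
  have hM0 : 0 ≤ M := integral_nonneg fun x => by positivity
  -- `2k - 2 = (2/N) * 2 + (1 - 2/N) * 2(1 + 2/N)`, so `θ = 1 - 2/N`.
  have hQle : Q ≤ M ^ (2 / N) * P ^ (1 - 2 / N) := by
    have h := integral_rpow_le_of_interpolation (μ := volume) hu.continuous hcs
      (p := 2 * (1 + 2 / N)) (q := 2 * k - 2) (r := 2) (θ := 1 - 2 / N) (by positivity) two_pos
      (by rw [sub_nonneg, div_le_one hN0]; exact hN2) (by rw [sub_le_self_iff]; positivity) (by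
        rw [hkdef]
        field_simp
        ring)
    simpa using h
  have hX : (P ^ ((N - 1) / N)) ^ 2 ≤ 4 * (k * F) * (k * Q) := by
    refine sq_le_four_mul_of_forall_le (by positivity) (by positivity) (by positivity) fun lam hl => ?_
    have h := integral_rpow_le_weighted hn hN hk hl ho hb hc hu hcs hs
    rw [← hp, ← hP, ← hF, ← hQ] at h
    have h2 := Real.rpow_le_rpow hP0 h (by positivity : 0 ≤ (N - 1) / N)
    rw [← Real.rpow_mul (by positivity), show N / (N - 1) * ((N - 1) / N) = 1 by field_simp,
      Real.rpow_one] at h2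
    refine h2.trans_eq ?_
    ring
  rcases hP0.eq_or_lt with hP00 | hPpos
  · rw [← hP00]
    positivity
  -- As `2(N - 1)/N = 1 + (1 - 2/N)`, the power of `P` from interpolation cancels and exactly one
  -- factor `P` remains.
  have hsplit : (P ^ ((N - 1) / N)) ^ 2 = P * P ^ (1 - 2 / N) := by
    rw [← Real.rpow_natCast, ← Real.rpow_mul hP0, ← Real.rpow_one_add' hP0 ?_]
    · congr 1
      field_simp
      push_cast
      ring
    · have : 0 ≤ 1 - 2 / N := by
        rw [sub_nonneg, div_le_one hN0]
        exact hN2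
      linarith
  rw [hsplit] at hX
  have hpos : 0 < P ^ (1 - 2 / N) := Real.rpow_pos_of_pos hPpos _
  refine le_of_mul_le_mul_right (hX.trans ?_) hpos
  calc 4 * (k * F) * (k * Q) ≤ 4 * (k * F) * (k * (M ^ (2 / N) * P ^ (1 - 2 / N))) := by gcongr
    _ = _ := by ring

end GridLines

/-! ### Supporting hyperplanes, boundary distance, and transfer to coordinates. -/

/-- A convex open set containing `x` lies in a half space whose boundary hyperplane is at most
`infDist x (frontier Ω)` away from `x`. -/
lemma exists_unit_inner_sub_le_infDist {E : Type*} [NormedAddCommGroup E] [InnerProductSpace ℝ E]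
    [FiniteDimensional ℝ E] {Ω : Set E} (ho : IsOpen Ω) (hc : Convex ℝ Ω)
    (hne : (frontier Ω).Nonempty) {x : E} (hx : x ∈ Ω) :
    ∃ ν : E, ‖ν‖ = 1 ∧ ∀ z ∈ Ω, inner ℝ ν (z - x) ≤ Metric.infDist x (frontier Ω) := by
  have : ProperSpace E := FiniteDimensional.proper ℝ E
  have : CompleteSpace E := FiniteDimensional.complete ℝ E
  obtain ⟨y, hy, hd⟩ := isClosed_frontier.exists_infDist_eq_dist hne x
  have hyΩ : y ∉ Ω := by
    rw [ho.frontier_eq] at hy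
    exact hy.2
  obtain ⟨f, hf⟩ := geometric_hahn_banach_open_point hc ho hyΩ
  set w := (InnerProductSpace.toDual ℝ E).symm f with hw
  have hfw : ∀ z, f z = inner ℝ w z := fun z => by simp [hw]
  have hw0 : w ≠ 0 := by
    intro h
    have := hf x hx
    simp [hfw, h] at this
  have hwn : 0 < ‖w‖ := norm_pos_iff.2 hw0
  refine ⟨‖w‖⁻¹ • w, by rw [norm_smul, norm_inv, norm_norm, inv_mul_cancel₀ hwn.ne'], fun z hz => ?_⟩
  rw [real_inner_smul_left, hd, inv_mul_le_iff₀ hwn]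
  have h1 : inner ℝ w (z - x) ≤ inner ℝ w (y - x) := by
    have := hf z hz
    rw [hfw, hfw] at this
    rw [inner_sub_right, inner_sub_right]
    linarith
  refine h1.trans ((real_inner_le_norm _ _).trans_eq ?_)
  rw [dist_comm, dist_eq_norm]

lemma infDist_frontier_pos {E : Type*} [NormedAddCommGroup E] {Ω : Set E} (ho : IsOpen Ω)
    (hne : (frontier Ω).Nonempty) {x : E} (hx : x ∈ Ω) : 0 < Metric.infDist x (frontier Ω) := by
  rw [← isClosed_frontier.notMem_iff_infDist_pos hne, ho.frontier_eq]
  exact fun h => h.2 hx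

lemma sq_div_sq_le_of_mul_le {ν d g : ℝ} (hd : 0 < d) (hg : 0 < g) (hν : 0 ≤ ν) (h : ν * g ≤ d) :
    ν ^ 2 / d ^ 2 ≤ 1 / g ^ 2 := by
  rw [div_le_div_iff₀ (by positivity) (by positivity), ← mul_pow, one_mul]
  exact pow_le_pow_left₀ (by positivity) h 2

section Transfer

variable {N : ℕ} {Ω : Set (EuclideanSpace ℝ (Fin N))}

lemma inner_toLp_update_sub (ν : EuclideanSpace ℝ (Fin N)) (y : Fin N → ℝ) (i : Fin N) (t : ℝ) :
    inner ℝ ν (WithLp.toLp 2 (Function.update y i t) - WithLp.toLp 2 y) = ν i * (t - y i) := by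
  have : WithLp.toLp 2 (Function.update y i t) - WithLp.toLp 2 y =
      EuclideanSpace.single i (t - y i) := by
    ext j
    by_cases hj : j = i
    · subst hj
      simp
    · simp [hj]
  rw [this, EuclideanSpace.inner_single_right]
  simp [mul_comm]

/-- Moving along `e_i` on the side given by the sign of `ν i`, the section ends within `d/|ν i|`.
That gap alone contributes `ν i²/d²`, and `‖ν‖ = 1`. -/
lemma one_div_sq_boundaryDist_le (ho : IsOpen Ω) (hb : Bornology.IsBounded Ω) (hc : Convex ℝ Ω)
    (hne : (frontier Ω).Nonempty) {y : Fin N → ℝ} (hy : WithLp.toLp 2 y ∈ Ω) :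
    1 / boundaryDist Ω (WithLp.toLp 2 y) ^ 2 ≤
      ∑ i, (1 / lowerGap (WithLp.toLp 2 ⁻¹' Ω) i y ^ 2 +
        1 / upperGap (WithLp.toLp 2 ⁻¹' Ω) i y ^ 2) := by
  set V : Set (Fin N → ℝ) := WithLp.toLp 2 ⁻¹' Ω with hV
  have hVo : IsOpen V := ho.preimage (PiLp.continuous_toLp 2 _)
  have hVb : Bornology.IsBounded V :=
    (PiLp.antilipschitzWith_toLp 2 (fun _ : Fin N => ℝ)).isBounded_preimage hb
  have hyV : y ∈ V := hy
  have hd := infDist_frontier_pos ho hne hy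
  obtain ⟨ν, hν, h⟩ := exists_unit_inner_sub_le_infDist ho hc hne hy
  unfold boundaryDist
  set d := Metric.infDist (WithLp.toLp 2 y) (frontier Ω) with hddef
  have hsum : 1 / d ^ 2 = ∑ i, ν i ^ 2 / d ^ 2 := by
    rw [← Finset.sum_div, ← EuclideanSpace.real_norm_sq_eq, hν, one_pow]
  rw [hsum]
  refine Finset.sum_le_sum fun i _ => ?_
  have hα := lowerGap_pos hVo hVb i hyV
  have hβ := upperGap_pos hVo hVb i hyV
  have hne' : {t | Function.update y i t ∈ V}.Nonempty := ⟨y i, by simpa using hyV⟩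
  have hline : ∀ t, Function.update y i t ∈ V → ν i * (t - y i) ≤ d := fun t ht => by
    rw [← inner_toLp_update_sub]
    exact h _ ht
  rcases le_or_gt 0 (ν i) with hi | hi
  · have : ν i ^ 2 / d ^ 2 ≤ 1 / upperGap V i y ^ 2 := by
      refine sq_div_sq_le_of_mul_le hd hβ hi ?_
      rcases hi.eq_or_lt with h0 | hpos
      · rw [← h0, zero_mul]
        exact hd.le
      have : upperEnd V i y ≤ d / ν i + y i := csSup_le hne' fun t ht => by
        rw [← sub_le_iff_le_add, le_div_iff₀ hpos, mul_comm]
        exact hline t ht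
      rw [mul_comm, ← le_div_iff₀ hpos]
      unfold upperGap
      linarith
    have h2 : 0 ≤ 1 / lowerGap V i y ^ 2 := by positivity
    linarith
  · have : ν i ^ 2 / d ^ 2 ≤ 1 / lowerGap V i y ^ 2 := by
      rw [← neg_sq]
      have hpos : 0 < - ν i := neg_pos.2 hi
      refine sq_div_sq_le_of_mul_le hd hα hpos.le ?_
      have : y i - d / (- ν i) ≤ lowerEnd V i y := le_csInf hne' fun t ht => by
        rw [sub_le_iff_le_add, ← sub_le_iff_le_add', le_div_iff₀ hpos]
        linarith [hline t ht]
      rw [mul_comm, ← le_div_iff₀ hpos]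
      unfold lowerGap
      linarith
    have h2 : 0 ≤ 1 / upperGap V i y ^ 2 := by positivity
    linarith

lemma partialDeriv_comp_toLp {u : EuclideanSpace ℝ (Fin N) → ℝ} (hu : Differentiable ℝ u)
    (i : Fin N) (y : Fin N → ℝ) :
    partialDeriv (fun y => u (WithLp.toLp 2 y)) i y = gradient u (WithLp.toLp 2 y) i := by
  have h := (hu (WithLp.toLp 2 y)).hasFDerivAt.comp y
    (PiLp.continuousLinearEquiv 2 ℝ (fun _ : Fin N => ℝ)).symm.hasFDerivAt
  have h2 : gradient u (WithLp.toLp 2 y) i =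
      inner ℝ (gradient u (WithLp.toLp 2 y)) (EuclideanSpace.single i 1) := by
    rw [EuclideanSpace.inner_single_right]
    simp
  rw [h2, inner_gradient_left, partialDeriv]
  exact congrArg (fun L => L (Pi.single i 1)) h.fderiv

lemma integral_toLp (h : EuclideanSpace ℝ (Fin N) → ℝ) :
    ∫ y : Fin N → ℝ, h (WithLp.toLp 2 y) = ∫ x, h x :=
  (EuclideanSpace.volume_preserving_symm_measurableEquiv_toLp (Fin N)).symm.integral_comp' h

end Transfer

/-! ### Comparing the energies and conclusion. -/

theorem theorem4p3 (N : ℕ) (hN : 2 ≤ N) (Ω : Set (EuclideanSpace ℝ (Fin N)))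
    (hΩ_open : IsOpen Ω) (hΩ_bdd : Bornology.IsBounded Ω) (hΩ_conv : Convex ℝ Ω)
    (hΩ_C2 : HasC2Boundary Ω) :
    ∃ C : ℝ, 0 < C ∧ ∀ u : EuclideanSpace ℝ (Fin N) → ℝ, IsTestFunction Ω u →
      C * (∫ x in Ω, |u x| ^ (2 * (1 + 2 / (N : ℝ)))) ≤
        (∫ x in Ω, (‖gradient u x‖ ^ 2 - u x ^ 2 / (4 * boundaryDist Ω x ^ 2))) *
          (∫ x in Ω, u x ^ 2) ^ (2 / (N : ℝ)) := by
  obtain ⟨n, rfl⟩ : ∃ n, N = n + 1 := ⟨N - 1, by omega⟩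
  obtain ⟨C, hC, hmain⟩ := exists_const_integral_rpow_le (n := n) (by omega)
    (N := ((n + 1 : ℕ) : ℝ)) (by push_cast; rfl)
  refine ⟨1 / C, by positivity, fun u hu => ?_⟩
  obtain ⟨hus, hucs, hsup⟩ := hu
  have hu1 : ContDiff ℝ 1 u := hus.of_le (by exact_mod_cast le_top)
  have hu0 : ∀ x ∉ Ω, u x = 0 := fun x hx => image_eq_zero_of_notMem_tsupport fun h => hx (hsup h)
  have hgrad0 : ∀ x ∉ tsupport u, gradient u x = 0 := fun x hx => by
    have : fderiv ℝ u x = 0 := by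
      by_contra h
      exact hx (support_fderiv_subset ℝ h)
    simp [gradient, this]
  have hgradc : Continuous (gradient u) :=
    (InnerProductSpace.toDual ℝ _).symm.continuous.comp (hu1.continuous_fderiv one_ne_zero)
  have hp : (2 * (1 + 2 / ((n + 1 : ℕ) : ℝ))) ≠ 0 := by positivity
  rw [setIntegral_eq_integral_of_forall_compl_eq_zero (fun x hx => by
      rw [hu0 x hx, abs_zero, Real.zero_rpow hp]),
    setIntegral_eq_integral_of_forall_compl_eq_zero (fun x hx => by
      rw [hu0 x hx, hgrad0 x fun h => hx (hsup h)]
      simp),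
    setIntegral_eq_integral_of_forall_compl_eq_zero (fun x hx => by
      rw [hu0 x hx]
      simp),
    ← integral_toLp, ← integral_toLp, ← integral_toLp]
  set V : Set (Fin (n + 1) → ℝ) := WithLp.toLp 2 ⁻¹' Ω with hV
  set v : (Fin (n + 1) → ℝ) → ℝ := fun y => u (WithLp.toLp 2 y) with hv
  have hVo : IsOpen V := hΩ_open.preimage (PiLp.continuous_toLp 2 _)
  have hVb : Bornology.IsBounded V :=
    (PiLp.antilipschitzWith_toLp 2 (fun _ : Fin (n + 1) => ℝ)).isBounded_preimage hΩ_bdd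
  have hVc : Convex ℝ V := hΩ_conv.linear_preimage
    (PiLp.continuousLinearEquiv 2 ℝ (fun _ : Fin (n + 1) => ℝ)).symm.toLinearMap
  have hvd : ContDiff ℝ 1 v :=
    hu1.comp (PiLp.continuousLinearEquiv 2 ℝ (fun _ : Fin (n + 1) => ℝ)).symm.contDiff
  have hvt : tsupport v = WithLp.toLp 2 ⁻¹' tsupport u := tsupport_comp_eq_preimage u
    (PiLp.continuousLinearEquiv 2 ℝ (fun _ : Fin (n + 1) => ℝ)).symm.toHomeomorph
  have hvcs : HasCompactSupport v := hucs.comp_homeomorph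
    (PiLp.continuousLinearEquiv 2 ℝ (fun _ : Fin (n + 1) => ℝ)).symm.toHomeomorph
  have hvs : tsupport v ⊆ V := by
    rw [hvt]
    exact preimage_mono hsup
  -- `infDist` to an empty set is `0`, so the frontier must be nonempty; boundedness excludes the
  -- whole space.
  have hfront : ∀ x ∈ Ω, (frontier Ω).Nonempty := fun x hx => by
    refine nonempty_frontier_iff.2 ⟨⟨x, hx⟩, ?_⟩
    rintro rfl
    exact NormedSpace.unbounded_univ ℝ (EuclideanSpace ℝ (Fin (n + 1))) hΩ_bdd
  have henergy : ∫ y, totalDensity V v y ≤ ∫ y : Fin (n + 1) → ℝ,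
      (‖gradient u (WithLp.toLp 2 y)‖ ^ 2 -
        v y ^ 2 / (4 * boundaryDist Ω (WithLp.toLp 2 y) ^ 2)) := by
    unfold totalDensity
    rw [integral_finsetSum _ fun i _ => integrable_directionalDensity hVo hVb hvd hvcs hvs i]
    simp_rw [integral_directionalDensity hVo hVb hVc hvd hvcs hvs]
    rw [← integral_finsetSum _ fun i _ => integrable_directional_energy hVo hVb hvd hvcs hvs i]
    refine integral_mono (integrable_finsetSum _ fun i _ =>
      integrable_directional_energy hVo hVb hvd hvcs hvs i) (Integrable.sub ?_ ?_) fun y => ?_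
    · refine ((hgradc.comp (PiLp.continuous_toLp 2 _)).norm.pow 2).integrable_of_hasCompactSupport
        (hvcs.mono' fun y hy => ?_)
      rw [hvt]
      by_contra h
      exact hy (by simp [hgrad0 _ h])
    · have hsub : tsupport (fun y => v y ^ 2) ⊆ tsupport v :=
        closure_mono fun y hy hy0 => hy (by simp [hy0])
      -- The weight is singular only at the boundary, away from the support of `v`.
      have hcont : ContinuousOn
          (fun y : Fin (n + 1) → ℝ => 1 / (4 * boundaryDist Ω (WithLp.toLp 2 y) ^ 2)) V := by
        refine continuousOn_const.div ?_ fun y hy => ?_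
        · exact (continuous_const.mul (((Metric.continuous_infDist_pt _).comp
            (PiLp.continuous_toLp 2 _)).pow 2)).continuousOn
        · have := infDist_frontier_pos hΩ_open (hfront _ hy) hy
          unfold boundaryDist
          positivity
      refine ((continuous_mul_of_tsupport_subset (hvd.continuous.pow 2) hcont hVo
        (hsub.trans hvs)).integrable_of_hasCompactSupport
        (hvcs.mono fun y hy hy0 => hy (by simp [hy0]))).congr (Filter.Eventually.of_forall fun y => ?_)
      simp only [Pi.pow_apply]
      ring
    · simp only
      rw [Finset.sum_sub_distrib, ← Finset.sum_div, ← Finset.mul_sum]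
      have h1 : ∑ i, partialDeriv v i y ^ 2 = ‖gradient u (WithLp.toLp 2 y)‖ ^ 2 := by
        rw [EuclideanSpace.real_norm_sq_eq]
        exact Finset.sum_congr rfl fun i _ => by
          rw [hv, partialDeriv_comp_toLp (hu1.differentiable one_ne_zero)]
      rw [h1]
      refine sub_le_sub_left ?_ _
      by_cases hy : WithLp.toLp 2 y ∈ Ω
      · have h2 := one_div_sq_boundaryDist_le hΩ_open hΩ_bdd hΩ_conv (hfront _ hy) hy
        calc v y ^ 2 / (4 * boundaryDist Ω (WithLp.toLp 2 y) ^ 2) =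
            v y ^ 2 * (1 / boundaryDist Ω (WithLp.toLp 2 y) ^ 2) / 4 := by ring
          _ ≤ _ := by gcongr
      · have : v y = 0 := hu0 _ hy
        simp [this]
  have h := hmain V v hVo hVb hVc hvd hvcs hvs
  rw [div_mul_eq_mul_div, one_mul, div_le_iff₀ hC]
  refine h.trans ?_
  have hM : 0 ≤ (∫ y, v y ^ 2) ^ (2 / ((n + 1 : ℕ) : ℝ)) :=
    Real.rpow_nonneg (integral_nonneg fun y => sq_nonneg _) _
  calc C * (∫ y, totalDensity V v y) * (∫ y, v y ^ 2) ^ (2 / ((n + 1 : ℕ) : ℝ)) ≤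
        C * (∫ y : Fin (n + 1) → ℝ, (‖gradient u (WithLp.toLp 2 y)‖ ^ 2 -
          v y ^ 2 / (4 * boundaryDist Ω (WithLp.toLp 2 y) ^ 2))) *
          (∫ y, v y ^ 2) ^ (2 / ((n + 1 : ℕ) : ℝ)) := by gcongr
    _ = _ := by ring
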